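/- For integers $0\le k\le m$ let $$\begin{bmatrix} m\\ k\end{bmatrix}_q=\frac{(q;q)_m}{(q;q)_k\,(q;q)_{m-k}}\in\mathbb Z[q],\qquad (q;q)_r=\prod_{s=1}^{r}(1-q^s),$$ denote the Gaussian $q$-binomial coefficient, let $\Phi_n(q)\in\mathbb Z[q]$ be the $n$-th cyclotomic polynomial, and let $\left(\frac{n}{3}\right)$ be the Legendre symbol modulo $3$ (equal to $0$, $1$, $-1$ according as $n\equiv 0,1,2 \pmod 3$). Then for every positive integer $n$, $$\sum_{i=0}^{n-1}\sum_{j=0}^{n-1} q^{j^2+i+j}\begin{bmatrix} i+j\\ i\end{bmatrix}_q^2\equiv \left(\frac{n}{3}\right) q^{\frac{n^2-1}{3}} \pmod{\Phi_n(q)^2},$$ that is, the difference of the two sides is divisible by $\Phi_n(q)^2$ in $\mathbb Z[q]$. When $3\mid n$ the right-hand side is understood to be $0$. -/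

import Mathlib

open Polynomial

/-- The `q`-shifted factorial `(a; q)_n = (1 - a) (1 - a q) ⋯ (1 - a q ^ (n - 1))`, with
`(a; q)_0 = 1`. -/
def qShiftedFactorial {R : Type*} [CommRing R] (a q : R) (n : ℕ) : R :=
  ∏ i ∈ Finset.range n, (1 - a * q ^ i)

/-- The Gaussian `q`-binomial coefficient `[n choose k]_q`, as a polynomial over `ℤ` in the
variable `q = X`, given by the `q`-Pascal recursion. By `algebraMap_qBinom` below it is equal, in
the field of rational functions, to `(q; q)_n / ((q; q)_k (q; q)_(n - k))` for `k ≤ n`, and it is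
`0` for `k > n`. -/
noncomputable def qBinom : ℕ → ℕ → ℤ[X]
  | _, 0 => 1
  | 0, _ + 1 => 0
  | n + 1, k + 1 => qBinom n k + X ^ (k + 1) * qBinom n (k + 1)

theorem qBinom_eq_zero_of_lt (n k : ℕ) (h : n < k) : qBinom n k = 0 := by
  induction n generalizing k with
  | zero =>
    obtain ⟨k, rfl⟩ := Nat.exists_eq_succ_of_ne_zero (by omega : k ≠ 0)
    rw [qBinom]
  | succ n ih =>
    obtain ⟨k, rfl⟩ := Nat.exists_eq_succ_of_ne_zero (by omega : k ≠ 0)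
    rw [qBinom, ih k (by omega), ih (k + 1) (by omega)]
    simp

theorem qShiftedFactorial_self_succ {R : Type*} [CommRing R] (q : R) (n : ℕ) :
    qShiftedFactorial q q (n + 1) = qShiftedFactorial q q n * (1 - q ^ (n + 1)) := by
  rw [qShiftedFactorial, Finset.prod_range_succ, ← qShiftedFactorial, pow_succ']

theorem qBinom_mul (m k : ℕ) :
    qBinom (m + k) k * (qShiftedFactorial X X k * qShiftedFactorial X X m)
      = qShiftedFactorial X X (m + k) := by
  suffices H : ∀ s m k : ℕ, m + k = s →
      qBinom (m + k) k * (qShiftedFactorial X X k * qShiftedFactorial X X m)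
        = qShiftedFactorial X X (m + k) from H _ m k rfl
  intro s
  induction s with
  | zero =>
    intro m k h
    obtain ⟨rfl, rfl⟩ : m = 0 ∧ k = 0 := by omega
    simp [qBinom, qShiftedFactorial]
  | succ s ih =>
    intro m k h
    cases k with
    | zero => cases m <;> simp [qBinom, qShiftedFactorial]
    | succ k =>
      cases m with
      | zero =>
        have h1 := ih 0 k (by omega)
        rw [Nat.zero_add] at h1 ⊢
        rw [qBinom, qBinom_eq_zero_of_lt k (k + 1) (by omega), qShiftedFactorial_self_succ]
        linear_combination (1 - X ^ (k + 1)) * h1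
      | succ m =>
        have h1 := ih (m + 1) k (by omega)
        have h2 := ih m (k + 1) (by omega)
        have e1 : m + 1 + k = m + (k + 1) := by omega
        have e2 : m + 1 + (k + 1) = (m + (k + 1)) + 1 := by omega
        rw [e1] at h1
        rw [e2, qBinom, qShiftedFactorial_self_succ X (m + (k + 1))]
        rw [qShiftedFactorial_self_succ] at h1 h2
        rw [qShiftedFactorial_self_succ X k, qShiftedFactorial_self_succ X m]
        linear_combination (1 - X ^ (k + 1)) * h1 + X ^ (k + 1) * (1 - X ^ (m + 1)) * h2

theorem qShiftedFactorial_X_ne_zero (n : ℕ) :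
    qShiftedFactorial (RatFunc.X : RatFunc ℤ) RatFunc.X n ≠ 0 := by
  rw [qShiftedFactorial, Finset.prod_ne_zero_iff]
  intro i _ h
  have h2 : algebraMap ℤ[X] (RatFunc ℤ) (1 - X ^ (i + 1)) = 0 := by
    rw [← h]
    simp [pow_succ']
  have h3 := (map_eq_zero_iff _ (RatFunc.algebraMap_injective ℤ)).1 h2
  have h4 := congrArg (Polynomial.eval 0) h3
  simp at h4

/-- The polynomial `qBinom n k` is the Gaussian coefficient in its quotient form. -/
theorem algebraMap_qBinom (n k : ℕ) :
    algebraMap ℤ[X] (RatFunc ℤ) (qBinom n k) =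
      if k ≤ n then
        qShiftedFactorial RatFunc.X RatFunc.X n /
          (qShiftedFactorial RatFunc.X RatFunc.X k * qShiftedFactorial RatFunc.X RatFunc.X (n - k))
      else 0 := by
  split_ifs with h
  · obtain ⟨m, rfl⟩ := Nat.exists_eq_add_of_le' h
    rw [Nat.add_sub_cancel, eq_div_iff
      (mul_ne_zero (qShiftedFactorial_X_ne_zero k) (qShiftedFactorial_X_ne_zero m))]
    have hm : ∀ j : ℕ, algebraMap ℤ[X] (RatFunc ℤ) (qShiftedFactorial X X j) =
        qShiftedFactorial RatFunc.X RatFunc.X j := by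
      intro j
      simp [qShiftedFactorial]
    rw [← hm, ← hm, ← hm, ← map_mul, ← map_mul, qBinom_mul]
  · rw [qBinom_eq_zero_of_lt n k (by omega), map_zero]

/-! Terms with `i + j ≥ n` contain the square of a coefficient divisible by `Φ_n`; on each remaining
diagonal `i + j = m`, q-Vandermonde gives `q^m [2m, m]`. So the double sum is congruent to `∑_{m<n}
q^m [2m, m]`, which `sum_central_qBinom` rewrites exactly as an alternating sum over row `2n`, at
distances from the centre prime to 3. Divisibility by `Φ_n^2` amounts to the vanishing of value and
derivative at one primitive root `ζ = η^2`, `η^n = -1`. Off the centre and the ends, row `2n`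
vanishes at `ζ` and its derivatives are explicit (`aeval_derivative_qBinom`), so the derivative of
the alternating sum becomes a finite Appell-type sum. That sum cancels when `3 ∣ n`; otherwise
recentring at an inverse of 3 modulo `n`, up to sign, gives a Lambert-type sum, evaluated by a
recursion and the symmetry `s ↦ n - s`. For `3 ∤ n` the coefficient at the end of the row adds a
monomial. -/

/-! ### Gaussian coefficients and q-Vandermonde. -/

theorem qShiftedFactorial_X_ne_zero_int (n : ℕ) :
    qShiftedFactorial (X : ℤ[X]) X n ≠ 0 := by
  rw [qShiftedFactorial, Finset.prod_ne_zero_iff]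
  intro i _ h
  simpa using congrArg (Polynomial.eval 0) h

theorem qBinom_zero_right (n : ℕ) : qBinom n 0 = 1 := by
  cases n <;> rw [qBinom]

theorem qBinom_self (n : ℕ) : qBinom n n = 1 := by
  induction n with
  | zero => rw [qBinom]
  | succ n ih => rw [qBinom, ih, qBinom_eq_zero_of_lt n (n + 1) (by omega)]; simp

theorem qBinom_symm_add (m k : ℕ) : qBinom (m + k) m = qBinom (m + k) k := by
  have h1 := qBinom_mul m k
  have h2 := qBinom_mul k m
  rw [add_comm k m] at h2
  refine mul_right_cancel₀ (mul_ne_zero (qShiftedFactorial_X_ne_zero_int k)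
    (qShiftedFactorial_X_ne_zero_int m)) ?_
  rw [h1, ← h2]
  ring

theorem qBinom_absorb (n k : ℕ) :
    (1 - X ^ (k + 1)) * qBinom n (k + 1) = (1 - X ^ (n - k)) * qBinom n k := by
  rcases lt_trichotomy n k with h | rfl | h
  · rw [qBinom_eq_zero_of_lt n k h, qBinom_eq_zero_of_lt n (k + 1) (by omega)]
    simp
  · rw [qBinom_eq_zero_of_lt n (n + 1) (by omega)]
    simp
  · obtain ⟨m, rfl⟩ := Nat.exists_eq_add_of_lt h
    have h1 := qBinom_mul m (k + 1)
    have h2 := qBinom_mul (m + 1) k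
    rw [show m + (k + 1) = k + m + 1 by omega, qShiftedFactorial_self_succ X k] at h1
    rw [show m + 1 + k = k + m + 1 by omega, qShiftedFactorial_self_succ X m] at h2
    rw [show k + m + 1 - k = m + 1 by omega]
    refine mul_right_cancel₀ (mul_ne_zero (qShiftedFactorial_X_ne_zero_int k)
      (qShiftedFactorial_X_ne_zero_int m)) ?_
    linear_combination h1 - h2

theorem qBinom_succ_succ (n k : ℕ) :
    qBinom (n + 1) (k + 1) = qBinom n k + X ^ (k + 1) * qBinom n (k + 1) := by
  rw [qBinom]

theorem qBinom_succ_succ' (n k : ℕ) :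
    qBinom (n + 1) (k + 1) = qBinom n (k + 1) + X ^ (n - k) * qBinom n k := by
  linear_combination qBinom_succ_succ n k - qBinom_absorb n k

/-- The shift `d` is kept free because the Pascal rule on the right-hand side calls for both `d` and
`d + 1`. -/
theorem qVandermonde (m k d : ℕ) :
    ∑ j ∈ Finset.range (k + 1), X ^ (j * (j + d)) * qBinom m (j + d) * qBinom k j
      = qBinom (m + k) (k + d) := by
  induction k generalizing d with
  | zero => simp [qBinom_zero_right]
  | succ k ih =>
    rw [← add_assoc, show k + 1 + d = k + d + 1 by omega, qBinom_succ_succ, ← ih d, add_assoc k d 1,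
      ← ih (d + 1), Finset.mul_sum, Finset.sum_range_succ']
    have key : ∀ j ∈ Finset.range (k + 1),
        (X : ℤ[X]) ^ ((j + 1) * (j + 1 + d)) * qBinom m (j + 1 + d) * qBinom (k + 1) (j + 1)
        = X ^ ((j + 1) * (j + 1 + d)) * qBinom m (j + 1 + d) * qBinom k (j + 1)
          + X ^ (k + (d + 1)) * (X ^ (j * (j + (d + 1))) * qBinom m (j + (d + 1)) * qBinom k j) := by
      intro j hj
      obtain ⟨l, rfl⟩ := Nat.exists_eq_add_of_le (Nat.lt_succ_iff.1 (Finset.mem_range.1 hj))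
      rw [qBinom_succ_succ', show j + l - j = l by omega, show j + (d + 1) = j + 1 + d by omega]
      ring
    rw [Finset.sum_congr rfl key, Finset.sum_add_distrib, Finset.sum_range_succ,
      Finset.sum_range_succ' (fun j => X ^ (j * (j + d)) * qBinom m (j + d) * qBinom k j),
      qBinom_eq_zero_of_lt k (k + 1) (by omega), qBinom_zero_right, qBinom_zero_right]
    ring

theorem sum_sq_qBinom (k : ℕ) :
    ∑ j ∈ Finset.range (k + 1), X ^ (j ^ 2) * qBinom k j ^ 2 = qBinom (2 * k) k := by
  have h := qVandermonde k k 0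
  rw [← two_mul, add_zero] at h
  rw [← h]
  exact Finset.sum_congr rfl fun j _ => by rw [add_zero]; ring

/-! ### The sum of central coefficients as an alternating row sum. -/

/-- The three-term expansion of the coefficients at distance `j + 1` from the centre. -/
theorem qBinom_central_succ (n j : ℕ) :
    qBinom (2 * (n + 1)) (n + 1 + (j + 1)) = qBinom (2 * n) (n + (j + 1))
      + X ^ (n + j + 2) * qBinom (2 * n) (n + (j + 2))
      + X ^ (2 * n + 1) * qBinom (2 * n) (n + (j + 1)) + X ^ (n - j) * qBinom (2 * n) (n + j) := by
  have h1 := qBinom_succ_succ' (2 * n + 1) (n + j + 1)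
  have h2 := qBinom_succ_succ (2 * n) (n + j + 1)
  have h3 := qBinom_succ_succ (2 * n) (n + j)
  rw [h2, h3] at h1
  rw [show 2 * (n + 1) = 2 * n + 1 + 1 by ring, show n + 1 + (j + 1) = n + j + 1 + 1 by ring, h1,
    show 2 * n + 1 - (n + j + 1) = n - j by omega, show n + (j + 1) = n + j + 1 by ring,
    show n + (j + 2) = n + j + 1 + 1 by ring]
  rcases lt_or_ge (2 * n) (n + j + 1) with h | h
  · rw [qBinom_eq_zero_of_lt (2 * n) (n + j + 1) h]
    ring
  · obtain ⟨l, rfl⟩ := Nat.exists_eq_add_of_le (show j ≤ n by omega)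
    rw [Nat.add_sub_cancel_left]
    ring

/-- When `n` increases by one, the increments of the blocks on the right telescope in `i`. The bound
on `M` only ensures that every nonzero coefficient is included. -/
theorem sum_central_qBinom (M n : ℕ) (hn : n ≤ 3 * M) :
    ∑ k ∈ Finset.range n, X ^ k * qBinom (2 * k) k
      = ∑ i ∈ Finset.range M, (X ^ (6 * i ^ 2 + 3 * i) * qBinom (2 * n) (n + (3 * i + 1))
          - X ^ (6 * i ^ 2 + 9 * i + 3) * qBinom (2 * n) (n + (3 * i + 2))) := by
  induction n with
  | zero =>
    rw [Finset.sum_range_zero, Finset.sum_eq_zero]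
    intro i _
    rw [qBinom_eq_zero_of_lt _ _ (by omega), qBinom_eq_zero_of_lt _ _ (by omega)]
    simp
  | succ n ih =>
    -- Truncation of `n - j` is harmless: the coefficient is zero once `j > n`.
    have hu : ∀ j, (X : ℤ[X]) ^ j * (X ^ (n - j) * qBinom (2 * n) (n + j))
        = X ^ n * qBinom (2 * n) (n + j) := by
      intro j
      rcases lt_or_ge n j with h | h
      · rw [qBinom_eq_zero_of_lt _ _ (by omega)]
        simp
      · rw [← mul_assoc, ← pow_add, Nat.add_sub_cancel' h]
    -- The telescoping quantity: `w 0` is the new summand `X^n [2n, n]`, and `w M = 0`.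
    set w : ℕ → ℤ[X] := fun i => X ^ (6 * i ^ 2 + 3 * i) *
      (X ^ (n - 3 * i) * qBinom (2 * n) (n + 3 * i)) with hw
    have hstep : ∀ i ∈ Finset.range M,
        X ^ (6 * i ^ 2 + 3 * i) * qBinom (2 * (n + 1)) (n + 1 + (3 * i + 1))
          - X ^ (6 * i ^ 2 + 9 * i + 3) * qBinom (2 * (n + 1)) (n + 1 + (3 * i + 2))
        = (X ^ (6 * i ^ 2 + 3 * i) * qBinom (2 * n) (n + (3 * i + 1))
          - X ^ (6 * i ^ 2 + 9 * i + 3) * qBinom (2 * n) (n + (3 * i + 2))) + (w i - w (i + 1)) := by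
      intro i _
      have e1 := qBinom_central_succ n (3 * i)
      have e2 := qBinom_central_succ n (3 * i + 1)
      have a1 := qBinom_absorb (2 * n) (n + (3 * i + 1))
      have u1 := hu (3 * i + 1)
      have u3 := hu (3 * i + 3)
      rw [show 2 * n - (n + (3 * i + 1)) = n - (3 * i + 1) by omega,
        show n + (3 * i + 1) + 1 = n + (3 * i + 2) by omega] at a1
      simp only [hw, show 3 * (i + 1) = 3 * i + 3 by ring]
      rw [e1, show 3 * i + 2 = 3 * i + 1 + 1 by ring, e2]
      simp only [add_assoc, Nat.reduceAdd] at *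
      generalize (X : ℤ[X]) ^ (n - (3 * i + 1)) = U1 at *
      generalize (X : ℤ[X]) ^ (n - (3 * i + 3)) = U3 at *
      generalize qBinom (2 * n) (n + (3 * i + 1)) = B1 at *
      generalize qBinom (2 * n) (n + (3 * i + 2)) = B2 at *
      generalize qBinom (2 * n) (n + (3 * i + 3)) = B3 at *
      linear_combination X ^ (6 * i ^ 2 + 12 * i + 6) * u3 - X ^ (6 * i ^ 2 + 6 * i + 2) * u1
        - X ^ (6 * i ^ 2 + 3 * i + n + 1) * u1 + X ^ (6 * i ^ 2 + 6 * i + 2 + n) * a1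
    rw [Finset.sum_range_succ, ih (by omega), Finset.sum_congr rfl hstep, Finset.sum_add_distrib,
      Finset.sum_range_sub']
    simp only [hw]
    rw [qBinom_eq_zero_of_lt (2 * n) (n + 3 * M) (by omega)]
    simp

/-! ### Divisibility by `Φ_n^2` and reduction to the triangle `i + j < n`. -/

theorem cyclotomic_dvd_of_aeval_eq_zero {n : ℕ} (hn : 0 < n) {ζ : ℂ} (hζ : IsPrimitiveRoot ζ n)
    {p : ℤ[X]} (hp : aeval ζ p = 0) : cyclotomic n ℤ ∣ p := by
  rw [cyclotomic_eq_minpoly hζ hn]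
  exact minpoly.isIntegrallyClosed_dvd (hζ.isIntegral hn) hp

/-- Differentiating `X^n - 1 = Φ_n e` shows that `ζ` is a simple root of `Φ_n`, so in `p = Φ_n r`
the condition `p'(ζ) = 0` forces `r(ζ) = 0`. -/
theorem cyclotomic_sq_dvd_of_aeval_eq_zero {n : ℕ} (hn : 0 < n) {ζ : ℂ} (hζ : IsPrimitiveRoot ζ n)
    {p : ℤ[X]} (hp : aeval ζ p = 0) (hp' : aeval ζ (derivative p) = 0) :
    cyclotomic n ℤ ^ 2 ∣ p := by
  have hroot : aeval ζ (cyclotomic n ℤ) = 0 := by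
    rw [cyclotomic_eq_minpoly hζ hn]
    exact minpoly.aeval _ _
  obtain ⟨r, rfl⟩ := cyclotomic_dvd_of_aeval_eq_zero hn hζ hp
  obtain ⟨e, he⟩ := cyclotomic.dvd_X_pow_sub_one n ℤ
  have hd := congrArg (fun p => aeval ζ (derivative p)) he
  simp only [derivative_mul, map_add, map_mul, hroot, zero_mul, add_zero, derivative_sub,
    derivative_X_pow, derivative_one, map_pow, map_natCast, aeval_X, sub_zero] at hd hp'
  have hne : aeval ζ (derivative (cyclotomic n ℤ)) ≠ 0 := by
    intro h
    rw [h, zero_mul] at hd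
    exact mul_ne_zero (Nat.cast_ne_zero.2 hn.ne') (pow_ne_zero _ (hζ.ne_zero hn.ne')) hd
  rw [pow_two]
  exact mul_dvd_mul_left _
    (cyclotomic_dvd_of_aeval_eq_zero hn hζ ((mul_eq_zero.1 hp').resolve_left hne))

/-- The numerator `(q; q)_(i+j)` contains `1 - q^n`, while neither denominator factor vanishes at
`ζ`. -/
theorem aeval_qBinom_eq_zero {n : ℕ} {ζ : ℂ} (hζ : IsPrimitiveRoot ζ n)
    {i j : ℕ} (hi : i < n) (hj : j < n) (hij : n ≤ i + j) : aeval ζ (qBinom (i + j) i) = 0 := by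
  have hval : ∀ m, aeval ζ (qShiftedFactorial (X : ℤ[X]) X m)
      = ∏ s ∈ Finset.range m, (1 - ζ ^ (s + 1)) := by
    intro m
    simp [qShiftedFactorial, pow_succ']
  have hne : ∀ m < n, aeval ζ (qShiftedFactorial (X : ℤ[X]) X m) ≠ 0 := by
    intro m hm
    rw [hval, Finset.prod_ne_zero_iff]
    intro s hs h
    have := Finset.mem_range.1 hs
    exact hζ.pow_ne_one_of_pos_of_lt (by omega) (by omega) (sub_eq_zero.1 h).symm
  have h := congrArg (aeval ζ) (qBinom_mul j i)
  rw [map_mul, map_mul, hval (j + i), Finset.prod_eq_zero (i := n - 1), add_comm j i] at h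
  · exact (mul_eq_zero.1 h).resolve_right (mul_ne_zero (hne i hi) (hne j hj))
  · exact Finset.mem_range.2 (by omega)
  · rw [Nat.sub_add_cancel (by omega), hζ.pow_eq_one, sub_self]

theorem cyclotomic_sq_dvd_sum_sub_sum {n : ℕ} (hn : 0 < n) :
    cyclotomic n ℤ ^ 2 ∣
      (∑ i ∈ Finset.range n, ∑ j ∈ Finset.range n,
          (X : ℤ[X]) ^ (j ^ 2 + i + j) * qBinom (i + j) i ^ 2)
        - ∑ k ∈ Finset.range n, X ^ k * qBinom (2 * k) k := by
  have hζ := Complex.isPrimitiveRoot_exp n hn.ne'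
  have hdiag := Finset.sum_range_diag_flip n fun j i =>
    (X : ℤ[X]) ^ (j ^ 2 + i + j) * qBinom (i + j) i ^ 2
  have hcentral : ∀ m ∈ Finset.range n, ∑ j ∈ Finset.range (m + 1),
      (X : ℤ[X]) ^ (j ^ 2 + (m - j) + j) * qBinom (m - j + j) (m - j) ^ 2
      = X ^ m * qBinom (2 * m) m := by
    intro m _
    rw [← sum_sq_qBinom, Finset.mul_sum]
    refine Finset.sum_congr rfl fun j hj => ?_
    rw [qBinom_symm_add, add_assoc,
      Nat.sub_add_cancel (Nat.lt_succ_iff.1 (Finset.mem_range.1 hj))]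
    ring
  rw [Finset.sum_congr rfl hcentral] at hdiag
  rw [hdiag, Finset.sum_comm, ← Finset.sum_sub_distrib]
  refine Finset.dvd_sum fun j hj => ?_
  have hj := Finset.mem_range.1 hj
  have hsplit := Finset.sum_range_add
    (fun i => (X : ℤ[X]) ^ (j ^ 2 + i + j) * qBinom (i + j) i ^ 2) (n - j) j
  rw [Nat.sub_add_cancel hj.le] at hsplit
  rw [hsplit, add_sub_cancel_left]
  refine Finset.dvd_sum fun i hi => Dvd.dvd.mul_left (pow_dvd_pow_of_dvd ?_ 2) _
  have hi := Finset.mem_range.1 hi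
  exact cyclotomic_dvd_of_aeval_eq_zero hn hζ
    (aeval_qBinom_eq_zero hζ (by omega) hj (by omega))

/-! ### Row `2n` at a primitive `n`-th root of unity. -/

theorem aeval_qBinom_central {n : ℕ} (hn : 0 < n) {ζ : ℂ} (hζ : IsPrimitiveRoot ζ n) :
    aeval ζ (qBinom (2 * n) n) = 2 := by
  rw [← sum_sq_qBinom, Finset.sum_range_succ, map_add, map_sum, Finset.sum_eq_single 0]
  · simp [qBinom_zero_right, qBinom_self, pow_two n, pow_mul, hζ.pow_eq_one]
    norm_num
  · intro j hj hj0
    have := Finset.mem_range.1 hj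
    have h := aeval_qBinom_eq_zero hζ (i := j) (j := n - j) (by omega) (by omega) (by omega)
    rw [Nat.add_sub_cancel' (by omega)] at h
    rw [map_mul, map_pow, map_pow, h]
    simp
  · simp [hn.ne']

theorem aeval_qBinom_two_mul_eq_zero {n : ℕ} {ζ : ℂ} (hζ : IsPrimitiveRoot ζ n)
    {j : ℕ} (h0 : 0 < j) (hj : j < n) : aeval ζ (qBinom (2 * n) (n + j)) = 0 := by
  induction j with
  | zero => omega
  | succ j ih =>
    have h := congrArg (aeval ζ) (qBinom_absorb (2 * n) (n + j))
    have hne : (1 : ℂ) - ζ ^ (n + j + 1) ≠ 0 := by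
      rw [add_assoc, pow_add, hζ.pow_eq_one, one_mul, sub_ne_zero]
      exact (hζ.pow_ne_one_of_pos_of_lt (by omega) hj).symm
    simp only [map_mul, map_sub, map_one, map_pow, aeval_X] at h
    rw [← add_assoc]
    refine (mul_eq_zero.1 (h.trans ?_)).resolve_left hne
    rcases Nat.eq_zero_or_pos j with rfl | hj0
    · simp [two_mul, hζ.pow_eq_one]
    · rw [ih hj0 (by omega), mul_zero]

/-- First-order behaviour of the coefficients of the middle row at a primitive `n`-th root of
unity `η ^ 2`. -/
theorem aeval_derivative_qBinom {n : ℕ} {η : ℂ} (hη : η ^ n = -1)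
    (hζ : IsPrimitiveRoot (η ^ 2) n) {j : ℕ} (hj : j + 1 < n) :
    η ^ 2 * (1 - (η ^ 2) ^ (j + 1)) * aeval (η ^ 2) (derivative (qBinom (2 * n) (n + (j + 1))))
      = -2 * n * η ^ (((n : ℤ) - (j + 1)) * j) := by
  have hn : 0 < n := by omega
  have hη0 : η ≠ 0 := by
    rintro rfl
    exact hζ.ne_zero hn.ne' (by simp)
  -- The absorption identity, differentiated at `ζ`. For `k = 0` only the central value 2
  -- contributes; for `k ≥ 1` only the previous derivative does.
  have hrel : ∀ k, k + 1 < n → (1 - (η ^ 2) ^ (k + 1)) *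
      aeval (η ^ 2) (derivative (qBinom (2 * n) (n + (k + 1))))
      = (1 - (η ^ 2) ^ (n - k)) * aeval (η ^ 2) (derivative (qBinom (2 * n) (n + k)))
        - ((n - k : ℕ) : ℂ) * (η ^ 2) ^ (n - k - 1) * aeval (η ^ 2) (qBinom (2 * n) (n + k)) := by
    intro k hk
    have h := congrArg (fun p => aeval (η ^ 2) (derivative p)) (qBinom_absorb (2 * n) (n + k))
    have hz := aeval_qBinom_two_mul_eq_zero hζ (Nat.succ_pos k) hk
    simp only [derivative_mul, derivative_one, derivative_X_pow, map_add, map_mul, map_sub,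
      map_zero, map_one, map_pow, map_natCast, aeval_X] at h
    rw [show 2 * n - (n + k) = n - k by omega, add_assoc n k 1, hz, pow_add (η ^ 2) n (k + 1),
      hζ.pow_eq_one] at h
    linear_combination h
  induction j with
  | zero =>
    have h := hrel 0 hj
    have h2 := aeval_qBinom_central hn hζ
    have hpow : η ^ 2 * (η ^ 2) ^ (n - 1) = 1 := by
      rw [← pow_succ', Nat.sub_add_cancel hn, hζ.pow_eq_one]
    simp only [Nat.sub_zero, add_zero, hζ.pow_eq_one, h2] at h
    simp only [Nat.cast_zero, mul_zero, zpow_zero]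
    linear_combination η ^ 2 * h - 2 * n * hpow
  | succ j ih =>
    have h := hrel (j + 1) hj
    rw [aeval_qBinom_two_mul_eq_zero hζ (Nat.succ_pos j) (by omega), mul_zero, sub_zero] at h
    have hpow : (η ^ 2) ^ (n - (j + 1)) * (η ^ 2) ^ (j + 1) = 1 := by
      rw [← pow_add, Nat.sub_add_cancel (by omega), hζ.pow_eq_one]
    -- Each step contributes `-ζ^(-(j+1))`; writing the sign as `η^n` keeps the answer a single
    -- power of `η`.
    have hexp : η ^ (((n : ℤ) - ((j + 1 : ℕ) + 1)) * (j + 1 : ℕ)) * (η ^ 2) ^ (j + 1)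
        = - η ^ (((n : ℤ) - (j + 1)) * j) := by
      rw [← pow_mul, ← zpow_natCast, ← zpow_add₀ hη0, neg_eq_neg_one_mul, ← hη, ← zpow_natCast,
        ← zpow_add₀ hη0]
      congr 1
      push_cast
      ring
    have hne : (η ^ 2) ^ (j + 1) ≠ 0 := pow_ne_zero _ (pow_ne_zero _ hη0)
    refine mul_right_cancel₀ hne ?_
    rw [mul_assoc (-2 * (n : ℂ)), hexp]
    linear_combination η ^ 2 * (η ^ 2) ^ (j + 1) * h - ih (by omega) -
      η ^ 2 * aeval (η ^ 2) (derivative (qBinom (2 * n) (n + (j + 1)))) * hpow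

/-! ### Lambert-type and Appell-type sums at roots of unity. -/

section RootOfUnitySums

variable {K : Type*} [Field K]

/-- The range `a, …, a + m - 1` is stable under `s ↦ n - s`, and `1/(1 - x) + 1/(1 - x⁻¹) = 1`. -/
theorem sum_one_div_one_sub_pow {Q : K} {n : ℕ} (hQ : Q ^ n = 1)
    (hne : ∀ s, 0 < s → s < n → Q ^ s ≠ 1) {a m : ℕ} (ha : 0 < a) (ham : 2 * a + m = n + 1) :
    2 * ∑ s ∈ Finset.range m, 1 / (1 - Q ^ (a + s)) = m := by
  rw [two_mul]
  nth_rewrite 2 [← Finset.sum_range_reflect]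
  rw [← Finset.sum_add_distrib, Finset.sum_congr rfl (g := fun _ => (1 : K)) ?_]
  · simp
  intro s hs
  have hs := Finset.mem_range.1 hs
  have hmul : Q ^ (a + s) * Q ^ (a + (m - 1 - s)) = 1 := by
    rw [← pow_add, show a + s + (a + (m - 1 - s)) = n by omega, hQ]
  have h1 := sub_ne_zero.2 (hne (a + s) (by omega) (by omega)).symm
  have h2 := sub_ne_zero.2 (hne (a + (m - 1 - s)) (by omega) (by omega)).symm
  rw [div_add_div _ _ h1 h2, div_eq_one_iff_eq (mul_ne_zero h1 h2)]
  linear_combination -hmul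

/-- Reflection `s ↦ 2c - 1 - s` preserves the exponent and reverses the sign. -/
theorem sum_neg_one_pow_zpow_eq_zero [CharZero K] {θ : K} (c : ℕ) :
    ∑ s ∈ Finset.range (2 * c), (-1) ^ s * θ ^ ((s : ℤ) * (s + 1 - 2 * c)) = 0 := by
  rw [← self_eq_neg]
  nth_rewrite 1 [← Finset.sum_range_reflect]
  rw [← Finset.sum_neg_distrib]
  refine Finset.sum_congr rfl fun s hs => ?_
  have hs := Finset.mem_range.1 hs
  obtain ⟨l, hl⟩ := Nat.exists_eq_add_of_lt hs
  have h1 : 2 * c - 1 - s = l := by omega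
  have h2 : (2 : ℤ) * c = s + l + 1 := by exact_mod_cast hl
  have h3 : (-1 : K) ^ l = -(-1) ^ s := by
    have h4 : (-1 : K) ^ (l + s + 1) = 1 := by
      rw [show l + s + 1 = 2 * c by omega, pow_mul]
      simp
    have h5 : (-1 : K) ^ s * (-1) ^ s = 1 := by rw [← mul_pow]; simp
    rw [pow_succ, pow_add] at h4
    linear_combination -(-1) ^ s * h4 - (-1) ^ l * h5
  rw [h1, h2, h3, neg_mul]
  congr 3
  ring

/-- The summand of the truncated Lambert-type sums. -/
def lambertTerm (θ : K) (t : ℤ) (s : ℕ) : K :=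
  (-1) ^ s * θ ^ ((s : ℤ) * (s + 1 - 2 * t)) / (1 - θ ^ (2 * s))

theorem lambertTerm_succ_sub {θ : K} (hθ : θ ≠ 0) (t : ℤ) {s : ℕ} (hs : θ ^ (2 * s) ≠ 1) :
    lambertTerm θ (t + 1) s - lambertTerm θ t s
      = (-1) ^ s * θ ^ ((s : ℤ) * (s + 1 - 2 * (t + 1))) := by
  have h1 := sub_ne_zero.2 hs.symm
  have h2 : θ ^ ((s : ℤ) * (s + 1 - 2 * t))
      = θ ^ ((s : ℤ) * (s + 1 - 2 * (t + 1))) * θ ^ (2 * s) := by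
    rw [← zpow_natCast θ (2 * s), ← zpow_add₀ hθ]
    congr 1
    push_cast
    ring
  rw [lambertTerm, lambertTerm, h2, ← sub_div, div_eq_iff h1]
  ring

/-- Raising `t` by one changes the sum over `1 ≤ s ≤ 2t` by an alternating sum that vanishes by
reflection, its end terms cancelling. Only the new term `s = 2t + 1`, of exponent zero, remains. -/
theorem sum_lambertTerm_odd_of_even [CharZero K] {θ : K} (hθ : θ ≠ 0) (t : ℕ)
    (hne : ∀ s, 0 < s → s ≤ 2 * t + 1 → θ ^ (2 * s) ≠ 1) :
    ∑ s ∈ Finset.range (2 * t + 1), lambertTerm θ (t + 1) (s + 1)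
      = ∑ s ∈ Finset.range (2 * t), lambertTerm θ t (s + 1) - 1 / (1 - θ ^ (2 * (2 * t + 1))) := by
  have h0 := sum_neg_one_pow_zpow_eq_zero (θ := θ) (t + 1)
  rw [show 2 * (t + 1) = 2 * t + 1 + 1 by ring, Finset.sum_range_succ,
    Finset.sum_range_succ', pow_succ _ (2 * t), pow_mul] at h0
  have e : ((2 * t + 1 : ℕ) : ℤ) + 1 - 2 * (t + 1) = 0 := by push_cast; ring
  rw [Nat.cast_add t 1, Nat.cast_one, e] at h0
  simp only [pow_zero, Nat.cast_zero, zero_mul, mul_zero, zpow_zero, even_two, Even.neg_pow,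
    one_pow, mul_one, one_mul, add_neg_cancel_right] at h0
  rw [Finset.sum_congr rfl fun s hs => (lambertTerm_succ_sub hθ t
    (hne (s + 1) (by omega) (by have := Finset.mem_range.1 hs; omega))).symm,
    Finset.sum_sub_distrib, sub_eq_zero] at h0
  rw [Finset.sum_range_succ, h0, lambertTerm, e, pow_succ _ (2 * t), pow_mul]
  simp only [mul_zero, zpow_zero, even_two, Even.neg_pow, one_pow, mul_one, one_mul]
  ring

theorem sum_lambertTerm_even [CharZero K] {θ : K} (hθ : θ ≠ 0) (t : ℕ)
    (hne : ∀ s, 0 < s → s ≤ 2 * t → θ ^ (2 * s) ≠ 1) :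
    ∑ s ∈ Finset.range (2 * t), lambertTerm θ t (s + 1)
      = ∑ c ∈ Finset.range t, 1 / (1 - θ ^ (2 * (c + 1)))
        - ∑ s ∈ Finset.range (2 * t), 1 / (1 - θ ^ (2 * (s + 1))) := by
  induction t with
  | zero => simp
  | succ t ih =>
    have hodd := sum_lambertTerm_odd_of_even hθ t fun s h1 h2 => hne s h1 (by omega)
    rw [ih fun s h1 h2 => hne s h1 (by omega)] at hodd
    -- This is `x/(1 - x^2) = 1/(1 - x) - 1/(1 - x^2)` at `x = θ^(2(t+1))`.
    have hlast : lambertTerm θ (t + 1) (2 * t + 1 + 1)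
        = 1 / (1 - θ ^ (2 * (t + 1))) - 1 / (1 - θ ^ (2 * (2 * t + 1 + 1))) := by
      have h1 := sub_ne_zero.2 (hne (t + 1) (by omega) (by omega)).symm
      have h2 := sub_ne_zero.2 (hne (2 * t + 1 + 1) (by omega) (by omega)).symm
      have e1 : ((2 * t + 1 + 1 : ℕ) : ℤ) * ((2 * t + 1 + 1 : ℕ) + 1 - 2 * (t + 1))
          = (2 * (t + 1) : ℕ) := by push_cast; ring
      have e2 : θ ^ (2 * (2 * t + 1 + 1)) = θ ^ (2 * (t + 1)) * θ ^ (2 * (t + 1)) := by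
        rw [← pow_add]
        ring_nf
      have e3 : (-1 : K) ^ (2 * t + 1 + 1) = 1 := by
        rw [show 2 * t + 1 + 1 = 2 * (t + 1) by ring, pow_mul]
        simp
      rw [lambertTerm, e1, e3, zpow_natCast, one_mul, div_sub_div _ _ h1 h2,
        div_eq_div_iff h2 (mul_ne_zero h1 h2), e2]
      ring
    rw [show 2 * (t + 1) = 2 * t + 1 + 1 by ring, Finset.sum_range_succ, Nat.cast_add t 1,
      Nat.cast_one, hodd, hlast, Finset.sum_range_succ _ t, Finset.sum_range_succ _ (2 * t + 1),
      Finset.sum_range_succ _ (2 * t)]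
    ring

/-- The indices `1, …, t` cancel; what remains, `t + 1, …, 2t`, is symmetric under `s ↦ 3t + 1 - s`.
-/
theorem two_mul_sum_lambertTerm_even [CharZero K] {θ : K} (hθ : θ ≠ 0) (t : ℕ)
    (h1 : (θ ^ 2) ^ (3 * t + 1) = 1) (hne : ∀ s, 0 < s → s < 3 * t + 1 → (θ ^ 2) ^ s ≠ 1) :
    2 * ∑ s ∈ Finset.range (2 * t), lambertTerm θ t (s + 1) = -t := by
  have hr := sum_one_div_one_sub_pow h1 hne (a := t + 1) (m := t) (by omega) (by omega)
  rw [sum_lambertTerm_even hθ t fun s h1 h2 => by rw [pow_mul]; exact hne s h1 (by omega)]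
  rw [two_mul t, Finset.sum_range_add, ← hr]
  simp only [pow_mul, add_right_comm t _ 1]
  ring

theorem two_mul_sum_lambertTerm_odd [CharZero K] {θ : K} (hθ : θ ≠ 0) (t : ℕ)
    (h1 : (θ ^ 2) ^ (3 * t + 2) = 1) (hne : ∀ s, 0 < s → s < 3 * t + 2 → (θ ^ 2) ^ s ≠ 1) :
    2 * ∑ s ∈ Finset.range (2 * t + 1), lambertTerm θ (t + 1) (s + 1) = -(t + 1) := by
  have hr := sum_one_div_one_sub_pow h1 hne (a := t + 1) (m := t + 1) (by omega) (by omega)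
  have hne' : ∀ s, 0 < s → s ≤ 2 * t + 1 → θ ^ (2 * s) ≠ 1 := fun s h1 h2 => by
    rw [pow_mul]
    exact hne s h1 (by omega)
  rw [sum_lambertTerm_odd_of_even hθ t hne', sum_lambertTerm_even hθ t fun s h1 h2 =>
    hne' s h1 (by omega), sub_sub, ← Finset.sum_range_succ (fun s => 1 / (1 - θ ^ (2 * (s + 1)))),
    show 2 * t + 1 = t + (t + 1) by ring, Finset.sum_range_add]
  push_cast at hr
  rw [← hr]
  simp only [pow_mul, add_right_comm t _ 1]
  ring

/-- The summand `(-1) ^ i q ^ (3 i (i + 1) / 2) / (1 - q ^ (3 i + 1))` at `q = η ^ 2`, where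
`η ^ n = -1`. -/
def appellTerm (η : K) (n : ℕ) (i : ℤ) : K :=
  η ^ (3 * i ^ 2 + 3 * i + n * i) / (1 - η ^ (6 * i + 2))

theorem zpow_eq_zpow_of_eq_add {η : K} {n : ℕ} (hη0 : η ≠ 0) (hη : η ^ n = -1) {a b : ℤ} (k : ℤ)
    (h : a = b + 2 * n * k) : η ^ a = η ^ b := by
  rw [h, zpow_add₀ hη0, zpow_mul, mul_comm (2 : ℤ), zpow_mul, zpow_natCast, hη]
  norm_num

theorem zpow_eq_neg_zpow_of_eq_add {η : K} {n : ℕ} (hη0 : η ≠ 0) (hη : η ^ n = -1) {a b : ℤ}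
    (k : ℤ) (h : a = b + n + 2 * n * k) : η ^ a = -η ^ b := by
  rw [zpow_eq_zpow_of_eq_add hη0 hη k h, zpow_add₀ hη0, zpow_natCast, hη]
  ring

/-- The shift `i ↦ i + t` fixes the denominator and negates the numerator, so negative indices
cancel nonnegative ones. -/
theorem sum_appellTerm_eq_zero {η : K} (hη0 : η ≠ 0) (t : ℕ) (hη : η ^ (3 * t) = -1) :
    ∑ i ∈ Finset.range t, (appellTerm η (3 * t) i + appellTerm η (3 * t) (-(i + 1))) = 0 := by
  rw [Finset.sum_add_distrib]
  nth_rewrite 1 [← Finset.sum_range_reflect]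
  rw [← Finset.sum_add_distrib]
  refine Finset.sum_eq_zero fun i hi => ?_
  obtain ⟨l, hl⟩ := Nat.exists_eq_add_of_lt (Finset.mem_range.1 hi)
  have h1 : ((t - 1 - i : ℕ) : ℤ) = -(i + 1) + t := by omega
  rw [h1, appellTerm, appellTerm, zpow_eq_neg_zpow_of_eq_add hη0 hη
    (a := 3 * (-((i : ℤ) + 1) + t) ^ 2 + 3 * (-((i : ℤ) + 1) + t)
      + (3 * t : ℕ) * (-((i : ℤ) + 1) + t)) (-(i + 1) + t)
    (b := 3 * (-((i : ℤ) + 1)) ^ 2 + 3 * (-((i : ℤ) + 1)) + (3 * t : ℕ) * (-((i : ℤ) + 1)))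
    (by push_cast; ring),
    zpow_eq_zpow_of_eq_add hη0 hη (a := 6 * (-((i : ℤ) + 1) + t) + 2) 1
      (b := 6 * (-((i : ℤ) + 1)) + 2) (by push_cast; ring)]
  ring

/-- As `τ` inverts 3 modulo `n`, the exponent `6(s - τ) + 2` equals `6s - 2n`, which turns the
denominator into `1 - θ^(2s)` with `θ = η^3`. -/
theorem appellTerm_eq_lambertTerm {η : K} {n : ℕ} (hη0 : η ≠ 0) (hη : η ^ n = -1) (τ : ℤ) (s : ℕ)
    (hτ : 3 * τ = n + 1) :
    appellTerm η n (s - τ) = η ^ (-2 * τ) * lambertTerm (η ^ 3) τ s := by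
  have e1 : η ^ (6 * (s - τ) + 2) = (η ^ 3) ^ (2 * s) := by
    rw [← pow_mul, ← zpow_natCast]
    exact zpow_eq_zpow_of_eq_add hη0 hη (-1) (by push_cast; linear_combination -2 * hτ)
  have e2 : η ^ (3 * (s - τ) ^ 2 + 3 * (s - τ) + n * (s - τ))
      = η ^ (-2 * τ) * ((-1) ^ s * (η ^ 3) ^ ((s : ℤ) * (s + 1 - 2 * τ))) := by
    rw [← hη, ← pow_mul, ← zpow_natCast, ← zpow_natCast η 3, ← zpow_mul, ← zpow_add₀ hη0,
      ← zpow_add₀ hη0]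
    congr 1
    push_cast
    linear_combination τ * hτ
  rw [appellTerm, lambertTerm, e1, e2, mul_div_assoc]

theorem appellTerm_eq_neg_lambertTerm {η : K} {n : ℕ} (hη0 : η ≠ 0) (hη : η ^ n = -1) (t : ℤ)
    (s : ℕ) (ht : 3 * t + 1 = n) (hs : (η ^ 3) ^ (2 * s) ≠ 1) :
    appellTerm η n (t - s) = -η ^ (2 * t) * lambertTerm (η ^ 3) t s := by
  have e1 : η ^ (6 * (t - s) + 2) * (η ^ 3) ^ (2 * s) = 1 := by
    rw [← pow_mul, ← zpow_natCast, ← zpow_add₀ hη0, ← zpow_zero η]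
    exact zpow_eq_zpow_of_eq_add hη0 hη 1 (by push_cast; linear_combination 2 * ht)
  have e2 : η ^ (3 * (t - s) ^ 2 + 3 * (t - s) + n * (t - s)) * (η ^ 3) ^ (2 * s)
      = η ^ (2 * t) * ((-1) ^ s * (η ^ 3) ^ ((s : ℤ) * (s + 1 - 2 * t))) := by
    rw [← hη, ← pow_mul, ← pow_mul, ← zpow_natCast, ← zpow_natCast, ← zpow_natCast η 3, ← zpow_mul,
      ← zpow_add₀ hη0, ← zpow_add₀ hη0, ← zpow_add₀ hη0]
    exact zpow_eq_zpow_of_eq_add hη0 hη (t - s) (by push_cast; linear_combination t * ht)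
  have h0 : (η ^ 3) ^ (2 * s) ≠ 0 := pow_ne_zero _ (pow_ne_zero _ hη0)
  have h1 := sub_ne_zero.2 hs.symm
  have h2 : 1 - η ^ (6 * (t - s) + 2) ≠ 0 := by
    intro h
    rw [← sub_eq_zero.1 h, one_mul] at e1
    exact hs e1
  rw [appellTerm, lambertTerm, ← mul_div_assoc, div_eq_div_iff h2 h1]
  refine mul_right_cancel₀ h0 ?_
  linear_combination (1 - (η ^ 3) ^ (2 * s)) * e2 - η ^ (2 * t) *
    ((-1) ^ s * (η ^ 3) ^ ((s : ℤ) * (s + 1 - 2 * t))) * e1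

theorem sum_appellTerm_of_three_mul_add_one [CharZero K] {η : K} (hη0 : η ≠ 0) (t : ℕ)
    (hη : η ^ (3 * t + 1) = -1)
    (hne : ∀ s, 0 < s → s < 3 * t + 1 → ((η ^ 3) ^ 2) ^ s ≠ 1) :
    2 * ∑ i ∈ Finset.range t,
      (appellTerm η (3 * t + 1) i + appellTerm η (3 * t + 1) (-(i + 1))) = t * (η ^ 2) ^ t := by
  have h1 : ((η ^ 3) ^ 2) ^ (3 * t + 1) = 1 := by
    rw [← pow_mul, ← pow_mul, ← mul_assoc, mul_comm, pow_mul, hη]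
    norm_num
  have hG := two_mul_sum_lambertTerm_even (pow_ne_zero 3 hη0) t h1 hne
  have hsum : ∑ i ∈ Finset.range t,
      (appellTerm η (3 * t + 1) i + appellTerm η (3 * t + 1) (-(i + 1)))
      = ∑ s ∈ Finset.range (2 * t), appellTerm η (3 * t + 1) (t - (s + 1 : ℕ)) := by
    rw [two_mul, Finset.sum_range_add, Finset.sum_add_distrib]
    nth_rewrite 1 [← Finset.sum_range_reflect]
    congr 1
    · refine Finset.sum_congr rfl fun i hi => ?_
      have := Finset.mem_range.1 hi
      congr 1
      omega
    · refine Finset.sum_congr rfl fun i hi => ?_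
      congr 1
      omega
  rw [hsum, Finset.sum_congr rfl fun s hs => appellTerm_eq_neg_lambertTerm hη0 hη t (s + 1)
    (by push_cast; ring) (by
      rw [pow_mul]
      exact hne (s + 1) (by omega) (by have := Finset.mem_range.1 hs; omega)),
    ← Finset.mul_sum, zpow_mul, zpow_natCast, zpow_ofNat]
  linear_combination -(η ^ 2) ^ t * hG

theorem sum_appellTerm_of_three_mul_add_two [CharZero K] {η : K} (hη0 : η ≠ 0) (t : ℕ)
    (hη : η ^ (3 * t + 2) = -1)
    (hne : ∀ s, 0 < s → s < 3 * t + 2 → ((η ^ 3) ^ 2) ^ s ≠ 1) :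
    2 * (∑ i ∈ Finset.range t,
      (appellTerm η (3 * t + 2) i + appellTerm η (3 * t + 2) (-(i + 1)))
      + appellTerm η (3 * t + 2) t) * (η ^ 2) ^ (t + 1) = -(t + 1) := by
  have h1 : ((η ^ 3) ^ 2) ^ (3 * t + 2) = 1 := by
    rw [← pow_mul, ← pow_mul, ← mul_assoc, mul_comm, pow_mul, hη]
    norm_num
  have hG := two_mul_sum_lambertTerm_odd (pow_ne_zero 3 hη0) t h1 hne
  have hsum : ∑ i ∈ Finset.range t,
      (appellTerm η (3 * t + 2) i + appellTerm η (3 * t + 2) (-(i + 1)))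
        + appellTerm η (3 * t + 2) t
      = ∑ s ∈ Finset.range (2 * t + 1),
        appellTerm η (3 * t + 2) ((s + 1 : ℕ) - ((t : ℤ) + 1)) := by
    rw [Finset.sum_add_distrib, add_right_comm,
      ← Finset.sum_range_succ (fun i : ℕ => appellTerm η (3 * t + 2) i),
      show 2 * t + 1 = t + (t + 1) by ring, Finset.sum_range_add _ t (t + 1), add_comm]
    nth_rewrite 1 [← Finset.sum_range_reflect]
    congr 1
    · refine Finset.sum_congr rfl fun i hi => ?_
      have := Finset.mem_range.1 hi
      congr 1
      omega
    · refine Finset.sum_congr rfl fun i hi => ?_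
      congr 1
      omega
  have hinv : η ^ (-2 * ((t : ℤ) + 1)) * (η ^ 2) ^ (t + 1) = 1 := by
    rw [← pow_mul, ← zpow_natCast, ← zpow_add₀ hη0, ← zpow_zero η]
    congr 1
    push_cast
    ring
  rw [hsum, Finset.sum_congr rfl fun s _ => appellTerm_eq_lambertTerm hη0 hη (t + 1) (s + 1)
    (by push_cast; ring), ← Finset.mul_sum, ← hG]
  linear_combination 2 * (∑ s ∈ Finset.range (2 * t + 1), lambertTerm (η ^ 3) (t + 1) (s + 1))
    * hinv

end RootOfUnitySums

/-! ### The derivative of the alternating row sum. -/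

theorem aeval_derivative_X_pow_mul {ζ : ℂ} {p : ℤ[X]} (hp : aeval ζ p = 0) (m : ℕ) :
    aeval ζ (derivative (X ^ m * p)) = ζ ^ m * aeval ζ (derivative p) := by
  rw [derivative_mul, map_add, map_mul, map_mul, hp, mul_zero, zero_add, map_pow, aeval_X]

theorem aeval_derivative_term_one {n : ℕ} {η : ℂ} (hη0 : η ≠ 0) (hη : η ^ n = -1)
    (hζ : IsPrimitiveRoot (η ^ 2) n) {i : ℕ} (hi : 3 * i + 1 < n) :
    η ^ 2 * aeval (η ^ 2)
        (derivative (X ^ (6 * i ^ 2 + 3 * i) * qBinom (2 * n) (n + (3 * i + 1))))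
      = -2 * n * appellTerm η n i := by
  have h := aeval_derivative_qBinom hη hζ hi
  have e1 : η ^ (6 * (i : ℤ) + 2) = (η ^ 2) ^ (3 * i + 1) := by
    rw [← pow_mul, ← zpow_natCast]
    congr 1
    push_cast
    ring
  have e2 : η ^ (3 * (i : ℤ) ^ 2 + 3 * i + n * i)
      = (η ^ 2) ^ (6 * i ^ 2 + 3 * i) * η ^ (((n : ℤ) - ((3 * i : ℕ) + 1)) * (3 * i : ℕ)) := by
    rw [← pow_mul, ← zpow_natCast, ← zpow_add₀ hη0]
    exact zpow_eq_zpow_of_eq_add hη0 hη (-i) (by push_cast; ring)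
  have hne := sub_ne_zero.2 (hζ.pow_ne_one_of_pos_of_lt (by omega : 3 * i + 1 ≠ 0) hi).symm
  rw [aeval_derivative_X_pow_mul (aeval_qBinom_two_mul_eq_zero hζ (by omega) hi), appellTerm,
    e1, e2, ← mul_div_assoc, eq_div_iff hne]
  linear_combination (η ^ 2) ^ (6 * i ^ 2 + 3 * i) * h

/-- The second family supplies the negative indices, so the two families form one bilateral
Appell-type sum. -/
theorem aeval_derivative_term_two {n : ℕ} {η : ℂ} (hη0 : η ≠ 0) (hη : η ^ n = -1)
    (hζ : IsPrimitiveRoot (η ^ 2) n) {i : ℕ} (hi : 3 * i + 2 < n) :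
    η ^ 2 * aeval (η ^ 2)
        (derivative (X ^ (6 * i ^ 2 + 9 * i + 3) * qBinom (2 * n) (n + (3 * i + 2))))
      = 2 * n * appellTerm η n (-(i + 1)) := by
  have h := aeval_derivative_qBinom hη hζ hi
  have e1 : η ^ (6 * (-((i : ℤ) + 1)) + 2) * (η ^ 2) ^ (3 * i + 1 + 1) = 1 := by
    rw [← pow_mul, ← zpow_natCast, ← zpow_add₀ hη0, ← zpow_zero η]
    congr 1
    push_cast
    ring
  have e2 : η ^ (3 * (-((i : ℤ) + 1)) ^ 2 + 3 * (-((i : ℤ) + 1)) + n * (-((i : ℤ) + 1)))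
        * (η ^ 2) ^ (3 * i + 1 + 1)
      = (η ^ 2) ^ (6 * i ^ 2 + 9 * i + 3)
        * η ^ (((n : ℤ) - ((3 * i + 1 : ℕ) + 1)) * (3 * i + 1 : ℕ)) := by
    rw [← pow_mul, ← pow_mul, ← zpow_natCast, ← zpow_natCast, ← zpow_add₀ hη0, ← zpow_add₀ hη0]
    exact zpow_eq_zpow_of_eq_add hη0 hη (-(2 * i + 1)) (by push_cast; ring)
  have h1 := hζ.pow_ne_one_of_pos_of_lt (by omega : 3 * i + 1 + 1 ≠ 0) hi
  have hne : 1 - η ^ (6 * (-((i : ℤ) + 1)) + 2) ≠ 0 := by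
    intro h0
    rw [← sub_eq_zero.1 h0, one_mul] at e1
    exact h1 e1
  have h0 : (η ^ 2) ^ (3 * i + 1 + 1) ≠ 0 := pow_ne_zero _ (pow_ne_zero _ hη0)
  rw [aeval_derivative_X_pow_mul (aeval_qBinom_two_mul_eq_zero hζ (by omega) hi), appellTerm,
    ← mul_div_assoc, eq_div_iff hne]
  refine mul_right_cancel₀ h0 ?_
  linear_combination -(η ^ 2) ^ (6 * i ^ 2 + 9 * i + 3) * h - 2 * n * e2 - η ^ 2 *
    (η ^ 2) ^ (6 * i ^ 2 + 9 * i + 3) *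
    aeval (η ^ 2) (derivative (qBinom (2 * n) (n + (3 * i + 2)))) * e1

/-- The alternating sum of the middle-row coefficients at distances `1, …, 3 * M` from the
centre. -/
noncomputable def centralSum (n M : ℕ) : ℤ[X] :=
  ∑ i ∈ Finset.range M, (X ^ (6 * i ^ 2 + 3 * i) * qBinom (2 * n) (n + (3 * i + 1))
    - X ^ (6 * i ^ 2 + 9 * i + 3) * qBinom (2 * n) (n + (3 * i + 2)))

theorem aeval_centralSum {n : ℕ} {ζ : ℂ} (hζ : IsPrimitiveRoot ζ n) {t : ℕ} (ht : 3 * t ≤ n) :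
    aeval ζ (centralSum n t) = 0 := by
  rw [centralSum, map_sum]
  refine Finset.sum_eq_zero fun i hi => ?_
  have := Finset.mem_range.1 hi
  rw [map_sub, map_mul, map_mul, aeval_qBinom_two_mul_eq_zero hζ (by omega) (by omega),
    aeval_qBinom_two_mul_eq_zero hζ (by omega) (by omega)]
  simp

theorem aeval_derivative_centralSum {n : ℕ} {η : ℂ} (hη0 : η ≠ 0) (hη : η ^ n = -1)
    (hζ : IsPrimitiveRoot (η ^ 2) n) {t : ℕ} (ht : 3 * t ≤ n) :
    η ^ 2 * aeval (η ^ 2) (derivative (centralSum n t))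
      = -2 * n * ∑ i ∈ Finset.range t, (appellTerm η n i + appellTerm η n (-(i + 1))) := by
  rw [centralSum, derivative_sum, map_sum, Finset.mul_sum, Finset.mul_sum]
  refine Finset.sum_congr rfl fun i hi => ?_
  have := Finset.mem_range.1 hi
  rw [derivative_sub, map_sub, mul_sub, aeval_derivative_term_one hη0 hη hζ (by omega),
    aeval_derivative_term_two hη0 hη hζ (by omega)]
  ring

theorem mul_aeval_derivative_X_pow (ζ : ℂ) (m : ℕ) :
    ζ * aeval ζ (derivative (X ^ m : ℤ[X])) = m * ζ ^ m := by
  cases m with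
  | zero => simp
  | succ m =>
    simp only [derivative_X_pow, map_mul, map_natCast, map_pow, aeval_X, Nat.add_sub_cancel]
    ring

theorem exists_pow_eq_neg_one_isPrimitiveRoot_sq {n : ℕ} (hn : 0 < n) :
    ∃ η : ℂ, η ^ n = -1 ∧ IsPrimitiveRoot (η ^ 2) n := by
  have h := Complex.isPrimitiveRoot_exp (2 * n) (by omega)
  refine ⟨_, (sq_eq_sq_iff_eq_or_eq_neg.1 ?_).resolve_left
    (h.pow_ne_one_of_pos_of_lt hn.ne' (by omega)), h.pow (by omega) rfl⟩
  rw [one_pow, ← pow_mul, mul_comm n 2, h.pow_eq_one]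

/-! ### The three residue classes modulo 3 and the conclusion. -/

theorem cyclotomic_sq_dvd_three_mul {t : ℕ} (ht : 0 < t) :
    cyclotomic (3 * t) ℤ ^ 2 ∣ centralSum (3 * t) t := by
  obtain ⟨η, hη, hζ⟩ := exists_pow_eq_neg_one_isPrimitiveRoot_sq (n := 3 * t) (by omega)
  have hζ0 := hζ.ne_zero (by omega)
  have hη0 : η ≠ 0 := fun h => hζ0 (by rw [h]; simp)
  refine cyclotomic_sq_dvd_of_aeval_eq_zero (by omega) hζ (aeval_centralSum hζ le_rfl)
    (mul_left_cancel₀ hζ0 ?_)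
  rw [aeval_derivative_centralSum hη0 hη hζ le_rfl, sum_appellTerm_eq_zero hη0 t hη, mul_zero,
    mul_zero]

theorem cyclotomic_sq_dvd_three_mul_add_one (t : ℕ) :
    cyclotomic (3 * t + 1) ℤ ^ 2 ∣
      centralSum (3 * t + 1) (t + 1) - X ^ (3 * t ^ 2 + 2 * t) := by
  obtain ⟨η, hη, hζ⟩ := exists_pow_eq_neg_one_isPrimitiveRoot_sq (n := 3 * t + 1) (by omega)
  have hζ0 := hζ.ne_zero (by omega)
  have hη0 : η ≠ 0 := fun h => hζ0 (by rw [h]; simp)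
  -- In the last block, distance `3t + 1 = n` is the end of the row, with coefficient 1, and
  -- distance `3t + 2` lies outside it.
  have hsplit : centralSum (3 * t + 1) (t + 1)
      = centralSum (3 * t + 1) t + X ^ (6 * t ^ 2 + 3 * t) := by
    rw [centralSum, Finset.sum_range_succ, ← centralSum, ← two_mul (3 * t + 1), qBinom_self,
      qBinom_eq_zero_of_lt _ _ (by omega)]
    ring
  have e1 : (η ^ 2) ^ (6 * t ^ 2 + 3 * t) = (η ^ 2) ^ t := by
    rw [show 6 * t ^ 2 + 3 * t = (3 * t + 1) * (2 * t) + t by ring, pow_add, pow_mul,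
      hζ.pow_eq_one, one_pow, one_mul]
  have e2 : (η ^ 2) ^ (3 * t ^ 2 + 2 * t) = (η ^ 2) ^ t := by
    rw [show 3 * t ^ 2 + 2 * t = (3 * t + 1) * t + t by ring, pow_add, pow_mul,
      hζ.pow_eq_one, one_pow, one_mul]
  rw [hsplit]
  refine cyclotomic_sq_dvd_of_aeval_eq_zero (by omega) hζ ?_ (mul_left_cancel₀ hζ0 ?_)
  · rw [map_sub, map_add, aeval_centralSum hζ (by omega), map_pow, map_pow, aeval_X, e1, e2]
    ring
  · have hQ : IsPrimitiveRoot ((η ^ 3) ^ 2) (3 * t + 1) := by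
      rw [pow_right_comm]
      exact hζ.pow_of_coprime 3 (by simp)
    have h := sum_appellTerm_of_three_mul_add_one hη0 t hη fun s h1 h2 =>
      hQ.pow_ne_one_of_pos_of_lt h1.ne' h2
    rw [derivative_sub, derivative_add, map_sub, map_add, mul_sub, mul_add,
      aeval_derivative_centralSum hη0 hη hζ (by omega), mul_aeval_derivative_X_pow,
      mul_aeval_derivative_X_pow, e1, e2]
    push_cast
    -- The coefficients of `ζ^t` balance: `-(3t+1)t + (6t^2+3t) = 3t^2+2t`.
    linear_combination -(3 * (t : ℂ) + 1) * h

theorem cyclotomic_sq_dvd_three_mul_add_two (t : ℕ) :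
    cyclotomic (3 * t + 2) ℤ ^ 2 ∣
      centralSum (3 * t + 2) (t + 1) + X ^ (3 * t ^ 2 + 4 * t + 1) := by
  obtain ⟨η, hη, hζ⟩ := exists_pow_eq_neg_one_isPrimitiveRoot_sq (n := 3 * t + 2) (by omega)
  have hζ0 := hζ.ne_zero (by omega)
  have hη0 : η ≠ 0 := fun h => hζ0 (by rw [h]; simp)
  -- Here distance `3t + 1 = n - 1` is still interior and supplies the unpaired Appell term at `t`;
  -- distance `n` gives the monomial.
  have hsplit : centralSum (3 * t + 2) (t + 1) = centralSum (3 * t + 2) t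
      + X ^ (6 * t ^ 2 + 3 * t) * qBinom (2 * (3 * t + 2)) (3 * t + 2 + (3 * t + 1))
      - X ^ (6 * t ^ 2 + 9 * t + 3) := by
    rw [centralSum, Finset.sum_range_succ, ← centralSum, ← two_mul (3 * t + 2), qBinom_self]
    ring
  have e1 : (η ^ 2) ^ (6 * t ^ 2 + 9 * t + 3) * (η ^ 2) ^ (t + 1) = 1 := by
    rw [← pow_add, show 6 * t ^ 2 + 9 * t + 3 + (t + 1) = (3 * t + 2) * (2 * t + 2) by ring,
      pow_mul, hζ.pow_eq_one, one_pow]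
  have e2 : (η ^ 2) ^ (3 * t ^ 2 + 4 * t + 1) * (η ^ 2) ^ (t + 1) = 1 := by
    rw [← pow_add, show 3 * t ^ 2 + 4 * t + 1 + (t + 1) = (3 * t + 2) * (t + 1) by ring,
      pow_mul, hζ.pow_eq_one, one_pow]
  have hne : (η ^ 2) ^ (t + 1) ≠ 0 := pow_ne_zero _ hζ0
  rw [hsplit]
  refine cyclotomic_sq_dvd_of_aeval_eq_zero (by omega) hζ ?_ (mul_left_cancel₀ hζ0 ?_)
  · rw [map_add, map_sub, map_add, aeval_centralSum hζ (by omega), map_mul,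
      aeval_qBinom_two_mul_eq_zero hζ (by omega) (by omega), map_pow, map_pow, map_pow, aeval_X]
    refine mul_right_cancel₀ hne ?_
    linear_combination e2 - e1
  · have hQ : IsPrimitiveRoot ((η ^ 3) ^ 2) (3 * t + 2) := by
      rw [pow_right_comm]
      exact hζ.pow_of_coprime 3 (by simp [Nat.odd_iff])
    have h := sum_appellTerm_of_three_mul_add_two hη0 t hη fun s h1 h2 =>
      hQ.pow_ne_one_of_pos_of_lt h1.ne' h2
    rw [derivative_add, derivative_sub, derivative_add, map_add, map_sub, map_add, mul_add, mul_sub,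
      mul_add, aeval_derivative_centralSum hη0 hη hζ (by omega),
      aeval_derivative_term_one hη0 hη hζ (by omega), mul_aeval_derivative_X_pow,
      mul_aeval_derivative_X_pow]
    refine mul_right_cancel₀ hne ?_
    push_cast
    linear_combination -(3 * (t : ℂ) + 2) * h - (6 * (t : ℂ) ^ 2 + 9 * t + 3) * e1
      + (3 * (t : ℂ) ^ 2 + 4 * t + 1) * e2

theorem legendreSym_three (t : ℕ) : legendreSym 3 (3 * t : ℕ) = 0 ∧
    legendreSym 3 (3 * t + 1 : ℕ) = 1 ∧ legendreSym 3 (3 * t + 2 : ℕ) = -1 := by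
  have h0 : ((3 * t : ℕ) : ℤ) % (3 : ℕ) = 0 := by omega
  have h1 : ((3 * t + 1 : ℕ) : ℤ) % (3 : ℕ) = 1 := by omega
  have h2 : ((3 * t + 2 : ℕ) : ℤ) % (3 : ℕ) = 2 := by omega
  refine ⟨?_, ?_, ?_⟩
  · rw [legendreSym.mod, h0, legendreSym.at_zero]
  · rw [legendreSym.mod, h1, legendreSym.at_one]
  · rw [legendreSym.mod, h2]
    decide

theorem theorem1p3 (n : ℕ) (hn : 0 < n) :
    cyclotomic n ℤ ^ 2 ∣
      (∑ i ∈ Finset.range n, ∑ j ∈ Finset.range n,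
          (X : ℤ[X]) ^ (j ^ 2 + i + j) * qBinom (i + j) i ^ 2)
        - C (legendreSym 3 (n : ℤ)) * X ^ ((n ^ 2 - 1) / 3) := by
  have hsum := cyclotomic_sq_dvd_sum_sub_sum hn
  rw [← dvd_sub_comm] at hsum
  suffices h : cyclotomic n ℤ ^ 2 ∣ ∑ k ∈ Finset.range n, X ^ k * qBinom (2 * k) k
      - C (legendreSym 3 (n : ℤ)) * X ^ ((n ^ 2 - 1) / 3) by
    have := dvd_sub h hsum
    rwa [sub_sub_sub_cancel_left] at this
  obtain ⟨t, rfl | rfl | rfl⟩ : ∃ t, n = 3 * t ∨ n = 3 * t + 1 ∨ n = 3 * t + 2 :=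
    ⟨n / 3, by omega⟩
  · rw [sum_central_qBinom t _ le_rfl, (legendreSym_three t).1, C_0, zero_mul, sub_zero]
    exact cyclotomic_sq_dvd_three_mul (by omega)
  · rw [sum_central_qBinom (t + 1) _ (by omega), (legendreSym_three t).2.1, C_1, one_mul,
      show ((3 * t + 1) ^ 2 - 1) / 3 = 3 * t ^ 2 + 2 * t by
        rw [show (3 * t + 1) ^ 2 = 3 * (3 * t ^ 2 + 2 * t) + 1 by ring]; omega]
    exact cyclotomic_sq_dvd_three_mul_add_one t
  · rw [sum_central_qBinom (t + 1) _ (by omega), (legendreSym_three t).2.2, C_neg, C_1,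
      neg_one_mul, sub_neg_eq_add, show ((3 * t + 2) ^ 2 - 1) / 3 = 3 * t ^ 2 + 4 * t + 1 by
        rw [show (3 * t + 2) ^ 2 = 3 * (3 * t ^ 2 + 4 * t + 1) + 1 by ring]; omega]
    exact cyclotomic_sq_dvd_three_mul_add_two t
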